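/- Let $n\ge 2$, let $A\in\mathbb R^{n\times n}$ be symmetric and $b\in\mathbb R^n$, and put $p=x^tAx+b^tx+1\in\mathbb R[x_1,\ldots,x_n]$. Suppose that $p$ is a real zero polynomial, i.e. $p(0)=1$ and for all $a\in\mathbb R^n$ and $\mu\in\mathbb C$, $p(\mu a)=0$ implies $\mu\in\mathbb R$. Suppose moreover that the matrix $\frac14 bb^t-A$ is invertible. Set $k=2^{\lfloor n/2\rfloor}$ (an even number, as $n\ge 2$). A determinantal representation of size $m$ of a polynomial $q\in\mathbb R[x_1,\ldots,x_n]$ is a tuple $(M_1,\ldots,M_n)$ of complex hermitian $m\times m$ matrices with $\det(I+x_1M_1+\cdots+x_nM_n)=q$. Two tuples $(M_i)$, $(N_i)$ of $m\times m$ matrices are unitarily equivalent if there is a unitary matrix $U$ with $N_i=U^*M_iU$ for all $i$. (1) Let $r\ge 1$ and let $(M_1,\ldots,M_n)$ be a determinantal representation of $p^r$ of size $2r$. Then $r=s\cdot\frac k2$ for some integer $s\ge 1$, and $(M_1,\ldots,M_n)$ is unitarily equivalent to a tuple of block diagonal matrices with $s$ blocks of size $k$, such that for each $j=1,\ldots,s$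 the tuple of $j$-th blocks is a determinantal representation of $p^{k/2}$. (2) If $n$ is even, then $p^{k/2}$ has a determinantal representation of size $k$, and any two such representations are unitarily equivalent. (3) If $n$ is odd, then up to unitary equivalence there are precisely two determinantal representations of $p^{k/2}$ of size $k$: there are two such representations that are not unitarily equivalent, and every such representation is unitarily equivalent to one of them. -/

import Mathlib

/-- A real zero polynomial: `p(0) = 1`, and for every real point `a` all complex zeros `μ` of
`p(μ a)` are real. -/
def IsRealZero {n : ℕ} (p : MvPolynomial (Fin n) ℝ) : Prop :=
  MvPolynomial.eval (0 : Fin n → ℝ) p = 1 ∧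
    ∀ (a : Fin n → ℝ) (μ : ℂ),
      MvPolynomial.aeval (fun i => μ * (a i : ℂ)) p = 0 → μ.im = 0

/-- The polynomial `xᵗ A x + bᵗ x + 1`. -/
noncomputable def quadraticPoly {n : ℕ} (A : Matrix (Fin n) (Fin n) ℝ) (b : Fin n → ℝ) :
    MvPolynomial (Fin n) ℝ :=
  (∑ i, ∑ j, MvPolynomial.C (A i j) * (MvPolynomial.X i * MvPolynomial.X j)) +
    (∑ i, MvPolynomial.C (b i) * MvPolynomial.X i) + 1

/-- The monic linear matrix polynomial `I + x₁ M₁ + ⋯ + xₙ Mₙ` of size `m`. -/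
noncomputable def linearMatrixPoly {n m : ℕ} (M : Fin n → Matrix (Fin m) (Fin m) ℂ) :
    Matrix (Fin m) (Fin m) (MvPolynomial (Fin n) ℂ) :=
  1 + ∑ i, (MvPolynomial.X i : MvPolynomial (Fin n) ℂ) • (M i).map MvPolynomial.C

/-- The tuple `M` is a (hermitian, monic) determinantal representation of `q` of size `m`: all
`M i` are hermitian and `det (I + x₁ M₁ + ⋯ + xₙ Mₙ) = q`. -/
def IsDetRep {n m : ℕ} (M : Fin n → Matrix (Fin m) (Fin m) ℂ) (q : MvPolynomial (Fin n) ℝ) :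
    Prop :=
  (∀ i, (M i).IsHermitian) ∧
    (linearMatrixPoly M).det = MvPolynomial.map (algebraMap ℝ ℂ) q

/-- Simultaneous unitary equivalence of two tuples of matrices. As the constant term `I` is
preserved by unitary conjugation, this is unitary equivalence of the corresponding monic linear
matrix polynomials. -/
def UnitarilyEquivalent {n m : ℕ} (M N : Fin n → Matrix (Fin m) (Fin m) ℂ) : Prop :=
  ∃ U ∈ Matrix.unitaryGroup (Fin m) ℂ, ∀ i, N i = star U * M i * U

/-- The tuple `M` of matrices of size `m` splits, after a unitary change of coordinates, into the
`s` diagonal blocks `B 0, …, B (s - 1)` of size `k` (so `m = k * s`). -/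
def SplitsInto {n m k s : ℕ} (M : Fin n → Matrix (Fin m) (Fin m) ℂ)
    (B : Fin s → Fin n → Matrix (Fin k) (Fin k) ℂ) : Prop :=
  ∃ e : Fin k × Fin s ≃ Fin m,
    UnitarilyEquivalent M
      (fun i => Matrix.reindex e e (Matrix.blockDiagonal fun j => B j i))

open Matrix
open scoped ComplexOrder

/-! Completing the square gives `p = (1 + c·x)² - xᵗDx` with `c = b/2` and `D = ¼bbᵗ - A`. The real
zero property makes `D` positive semidefinite, and invertibility then yields `D = SᵗS` with `S` real
and invertible (`IsRealZero.exists_normal_form`).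

The substitution `M_i = c_i I + ∑ S_{ki} E_k` is invertible and compatible with unitary equivalence
and direct sums. It matches determinantal representations of `p^r` of size `2r` with hermitian
tuples `E` for which `∑ y_k E_k` has characteristic polynomial `(X² - ∑ y_k²)^r`. For real `y`,
Cayley–Hamilton makes the hermitian matrix `(∑ y_k E_k)² - ∑ y_k²` nilpotent, hence zero, so the
`E_k` are anticommuting involutions: a hermitian representation of a Clifford algebra
(`IsCliffordTuple.of_charpoly`, converse `IsCliffordTuple.charpoly_sum_smul`).

These are classified by periodicity. Every tuple of `n + 2` such matrices is, up to unitary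
equivalence, the doubling of a tuple of `n`, and doubling preserves and reflects equivalence. For `n
= 0` the only building block is the empty tuple of size 1; for `n = 1` the blocks are `1` and `-1`.
Hence there is one building block for even `n` and two for odd `n`, of size `2^⌊n/2⌋`
(`exists_standard_cliffordTuple`). -/

theorem Matrix.eq_zero_of_eq_neg {ι κ : Type} {X : Matrix ι κ ℂ} (h : X = -X) : X = 0 := by
  ext i j
  exact self_eq_neg.1 (congrFun (congrFun h i) j)

/-- Unitary equivalence of tuples of matrices that may be indexed by different finite types. -/
def TupleEquiv {τ ι κ : Type} [Fintype ι] [Fintype κ] [DecidableEq ι] [DecidableEq κ]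
    (E : τ → Matrix ι ι ℂ) (F : τ → Matrix κ κ ℂ) : Prop :=
  ∃ U : Matrix ι κ ℂ, Uᴴ * U = 1 ∧ U * Uᴴ = 1 ∧ ∀ i, F i = Uᴴ * E i * U

/-- Tuples of pairwise anticommuting hermitian involutions. -/
structure IsCliffordTuple {τ ι : Type} [Fintype ι] [DecidableEq ι]
    (E : τ → Matrix ι ι ℂ) : Prop where
  herm : ∀ i, (E i)ᴴ = E i
  sq : ∀ i, E i * E i = 1
  anti : ∀ i j, i ≠ j → E i * E j = -(E j * E i)

/-! ### Unitary equivalence and its invariants -/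

section TupleEquiv

variable {τ ι κ μ : Type} [Fintype ι] [Fintype κ] [Fintype μ]
  [DecidableEq ι] [DecidableEq κ] [DecidableEq μ]

theorem TupleEquiv.symm {E : τ → Matrix ι ι ℂ} {F : τ → Matrix κ κ ℂ}
    (h : TupleEquiv E F) : TupleEquiv F E := by
  obtain ⟨U, h1, h2, h3⟩ := h
  refine ⟨Uᴴ, by simpa using h2, by simpa using h1, fun i => ?_⟩
  rw [h3, conjTranspose_conjTranspose]
  calc E i = (U * Uᴴ) * E i * (U * Uᴴ) := by rw [h2]; simp
    _ = _ := by simp only [Matrix.mul_assoc]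

theorem TupleEquiv.trans {E : τ → Matrix ι ι ℂ} {F : τ → Matrix κ κ ℂ} {G : τ → Matrix μ μ ℂ}
    (h : TupleEquiv E F) (h' : TupleEquiv F G) : TupleEquiv E G := by
  obtain ⟨U, h1, h2, h3⟩ := h
  obtain ⟨V, k1, k2, k3⟩ := h'
  refine ⟨U * V, ?_, ?_, fun i => ?_⟩
  · calc (U * V)ᴴ * (U * V) = Vᴴ * (Uᴴ * U) * V := by
          simp only [conjTranspose_mul, Matrix.mul_assoc]
      _ = 1 := by rw [h1, Matrix.mul_one, k1]
  · calc (U * V) * (U * V)ᴴ = U * (V * Vᴴ) * Uᴴ := by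
          simp only [conjTranspose_mul, Matrix.mul_assoc]
      _ = 1 := by rw [k2, Matrix.mul_one, h2]
  · rw [k3, h3]; simp only [conjTranspose_mul, Matrix.mul_assoc]

theorem TupleEquiv.reindex (e : ι ≃ κ) (E : τ → Matrix ι ι ℂ) :
    TupleEquiv E (fun i => Matrix.reindex e e (E i)) := by
  refine ⟨(1 : Matrix ι ι ℂ).submatrix id e.symm, ?_, ?_, fun i => ?_⟩
  · rw [conjTranspose_submatrix, ← submatrix_mul _ _ _ id _ Function.bijective_id]
    simp
  · rw [conjTranspose_submatrix, submatrix_mul_equiv]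
    simp
  · rw [conjTranspose_submatrix]
    ext a c
    simp [Matrix.mul_apply, Matrix.one_apply]

theorem TupleEquiv.card_eq {E : τ → Matrix ι ι ℂ} {F : τ → Matrix κ κ ℂ}
    (h : TupleEquiv E F) : Fintype.card ι = Fintype.card κ := by
  obtain ⟨U, h1, h2, -⟩ := h
  exact Matrix.square_of_invertible U Uᴴ h2 h1

theorem IsCliffordTuple.of_equiv {E : τ → Matrix ι ι ℂ} {F : τ → Matrix κ κ ℂ}
    (hE : IsCliffordTuple E) (h : TupleEquiv E F) : IsCliffordTuple F := by
  obtain ⟨U, h1, h2, h3⟩ := h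
  have key : ∀ i j, F i * F j = Uᴴ * (E i * E j) * U := fun i j => by
    rw [h3, h3]
    calc Uᴴ * E i * U * (Uᴴ * E j * U) = Uᴴ * E i * (U * Uᴴ) * E j * U := by
          simp only [Matrix.mul_assoc]
      _ = _ := by rw [h2]; simp only [Matrix.mul_assoc, Matrix.mul_one]
  refine ⟨fun i => ?_, fun i => ?_, fun i j hij => ?_⟩
  · simp [h3, conjTranspose_mul, hE.herm, Matrix.mul_assoc]
  · rw [key, hE.sq, Matrix.mul_one, h1]
  · rw [key, key, hE.anti i j hij]; simp

end TupleEquiv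

/-- The sign encoded by a Boolean. -/
def boolSign (t : Bool) : ℂ := if t then 1 else -1

/-! ### Clifford periodicity: passing between `n` and `n + 2` generators -/

section Doubling

variable {ι κ : Type} [Fintype ι] [Fintype κ] [DecidableEq ι] [DecidableEq κ]

theorem exists_diagonalization_of_sq_eq_one {E : Matrix ι ι ℂ} (hE : Eᴴ = E) (hsq : E * E = 1) :
    ∃ (W : Matrix ι ι ℂ) (σ : ι → Bool), Wᴴ * W = 1 ∧ W * Wᴴ = 1 ∧
      E = W * diagonal (fun i => boolSign (σ i)) * Wᴴ := by
  have hH : E.IsHermitian := hE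
  have h1 : (hH.eigenvectorUnitary : Matrix ι ι ℂ)ᴴ * hH.eigenvectorUnitary = 1 :=
    Unitary.coe_star_mul_self _
  have h2 : (hH.eigenvectorUnitary : Matrix ι ι ℂ) * (hH.eigenvectorUnitary : Matrix ι ι ℂ)ᴴ = 1 :=
    Unitary.coe_mul_star_self _
  have h3 : E = (hH.eigenvectorUnitary : Matrix ι ι ℂ) * diagonal (RCLike.ofReal ∘ hH.eigenvalues) *
      (hH.eigenvectorUnitary : Matrix ι ι ℂ)ᴴ := hH.spectral_theorem
  generalize (hH.eigenvectorUnitary : Matrix ι ι ℂ) = W at *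
  have h4 : diagonal (RCLike.ofReal ∘ hH.eigenvalues) = Wᴴ * E * W := by
    calc _ = (Wᴴ * W) * diagonal (RCLike.ofReal ∘ hH.eigenvalues) * (Wᴴ * W) := by
          rw [h1]; simp
      _ = Wᴴ * (W * diagonal (RCLike.ofReal ∘ hH.eigenvalues) * Wᴴ) * W := by
          simp only [Matrix.mul_assoc]
      _ = _ := by rw [← h3]
  have h5 : diagonal (RCLike.ofReal ∘ hH.eigenvalues) * diagonal (RCLike.ofReal ∘ hH.eigenvalues)
      = (1 : Matrix ι ι ℂ) := by
    rw [h4]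
    calc Wᴴ * E * W * (Wᴴ * E * W) = Wᴴ * E * (W * Wᴴ) * E * W := by
          simp only [Matrix.mul_assoc]
      _ = Wᴴ * (E * E) * W := by rw [h2]; simp only [Matrix.mul_assoc, Matrix.mul_one]
      _ = 1 := by rw [hsq, Matrix.mul_one, h1]
  refine ⟨W, fun i => decide (hH.eigenvalues i = 1), h1, h2, ?_⟩
  suffices h : (fun i => boolSign (decide (hH.eigenvalues i = 1))) =
      RCLike.ofReal ∘ hH.eigenvalues by
    rw [h]; exact h3
  ext i
  have h6 := congrFun (congrFun h5 i) i
  rw [diagonal_mul_diagonal, diagonal_apply_eq, one_apply_eq] at h6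
  have h7 : hH.eigenvalues i * hH.eigenvalues i = 1 := by
    have : ((hH.eigenvalues i * hH.eigenvalues i : ℝ) : ℂ) = 1 := by push_cast; exact h6
    exact_mod_cast this
  rcases mul_self_eq_one_iff.1 h7 with h | h <;> simp [boolSign, h]
  norm_num

/-- A hermitian involution gives an isometry onto its `+1`-eigenspace. -/
theorem exists_isometry_of_sq_eq_one {E : Matrix ι ι ℂ} (hE : Eᴴ = E) (hsq : E * E = 1) :
    ∃ (s : ℕ) (V : Matrix ι (Fin s) ℂ), Vᴴ * V = 1 ∧ V * Vᴴ = (1 / 2 : ℂ) • (1 + E) := by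
  obtain ⟨W, σ, h1, h2, h3⟩ := exists_diagonalization_of_sq_eq_one hE hsq
  let e := (Fintype.equivFin {i // σ i = true}).symm
  -- The columns of `W` belonging to the eigenvalue `+1` form an orthonormal basis of that
  -- eigenspace.
  refine ⟨_, W.submatrix id (fun a => (e a : ι)), ?_, ?_⟩
  · rw [conjTranspose_submatrix, ← submatrix_mul _ _ _ id _ Function.bijective_id, h1]
    ext a c
    simp [Matrix.one_apply, Subtype.val_injective.eq_iff]
  · have : (1 / 2 : ℂ) • (1 + E) = W * diagonal (fun i => if σ i = true then 1 else 0) * Wᴴ := by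
      have h4 : (diagonal (fun i => if σ i = true then 1 else 0) : Matrix ι ι ℂ) =
          (1 / 2 : ℂ) • (1 + diagonal (fun i => boolSign (σ i))) := by
        rw [← diagonal_one, diagonal_add, ← diagonal_smul]
        congr 1
        ext i
        by_cases h : σ i = true <;> simp [boolSign, h]
        norm_num
      rw [h4, h3, Matrix.mul_smul, Matrix.smul_mul, Matrix.mul_add, Matrix.add_mul, Matrix.mul_one,
        h2]
    rw [this]
    ext a c
    rw [Matrix.mul_apply, Matrix.mul_apply]
    simp only [conjTranspose_apply, submatrix_apply, id, mul_diagonal,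
      mul_ite, mul_one, mul_zero, ite_mul, zero_mul]
    rw [← Finset.sum_filter, ← Finset.sum_subtype_eq_sum_filter]
    simp only [Finset.subtype_univ]
    exact e.sum_comp (fun x : {i // σ i = true} => W a x * star (W c x))

/-- From `n` matrices of size `κ`, build `n + 2` matrices of size `κ ⊕ κ`. -/
noncomputable def doubleTuple {n : ℕ} (F : Fin n → Matrix κ κ ℂ) :
    Fin (n + 2) → Matrix (κ ⊕ κ) (κ ⊕ κ) ℂ :=
  Fin.cons (fromBlocks 1 0 0 (-1)) (Fin.cons (fromBlocks 0 1 1 0)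
    fun i => fromBlocks 0 (-Complex.I • F i) (Complex.I • F i) 0)

@[simp] theorem doubleTuple_zero {n : ℕ} {κ : Type} [DecidableEq κ] (F : Fin n → Matrix κ κ ℂ) :
    doubleTuple F 0 = fromBlocks 1 0 0 (-1) := rfl

@[simp] theorem doubleTuple_one {n : ℕ} {κ : Type} [DecidableEq κ] (F : Fin n → Matrix κ κ ℂ) :
    doubleTuple F 1 = fromBlocks 0 1 1 0 := rfl

@[simp] theorem doubleTuple_succ_succ {n : ℕ} {κ : Type} [DecidableEq κ] (F : Fin n → Matrix κ κ ℂ)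
    (i : Fin n) :
    doubleTuple F i.succ.succ = fromBlocks 0 (-Complex.I • F i) (Complex.I • F i) 0 := rfl

/-- The doubled matrices are `σ_z ⊗ 1`, `σ_x ⊗ 1` and `σ_y ⊗ F_i` for the Pauli matrices. These
anticommute and square to 1, so only the products `σ_y² ⊗ F_i F_j` involve the relations of `F`. -/
theorem IsCliffordTuple.double {n : ℕ} {F : Fin n → Matrix κ κ ℂ} (hF : IsCliffordTuple F) :
    IsCliffordTuple (doubleTuple F) := by
  refine ⟨fun i => ?_, fun i => ?_, fun i j hij => ?_⟩
  · refine Fin.cases ?_ (fun i => Fin.cases ?_ (fun i => ?_) i) i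
    · simp [fromBlocks_conjTranspose]
    · simp [fromBlocks_conjTranspose]
    · simp [fromBlocks_conjTranspose, hF.herm]
  · refine Fin.cases ?_ (fun i => Fin.cases ?_ (fun i => ?_) i) i
    · simp [fromBlocks_multiply]
    · simp [fromBlocks_multiply]
    · simp [fromBlocks_multiply, hF.sq, smul_smul]
  · revert hij
    refine Fin.cases ?_ (fun i => Fin.cases ?_ (fun i => ?_) i) i <;>
    refine Fin.cases ?_ (fun j => Fin.cases ?_ (fun j => ?_) j) j <;>
    intro hij
    any_goals simp [fromBlocks_multiply, fromBlocks_neg]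
    any_goals simp at hij
    have := hF.anti i j (by simpa using hij)
    simp [smul_smul, this]

theorem IsCliffordTuple.of_double {n : ℕ} {F : Fin n → Matrix κ κ ℂ}
    (h : IsCliffordTuple (doubleTuple F)) : IsCliffordTuple F := by
  refine ⟨fun i => ?_, fun i => ?_, fun i j hij => ?_⟩
  · have := h.herm i.succ.succ
    simp only [doubleTuple_succ_succ, fromBlocks_conjTranspose, fromBlocks_inj] at this
    have := this.2.1
    simpa using this
  · have := h.sq i.succ.succ
    rw [← fromBlocks_one] at this
    simp only [doubleTuple_succ_succ, fromBlocks_multiply, fromBlocks_inj] at this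
    simpa [smul_smul] using this.1
  · have := h.anti i.succ.succ j.succ.succ (by simpa using hij)
    simp only [doubleTuple_succ_succ, fromBlocks_multiply, fromBlocks_neg, fromBlocks_inj] at this
    simpa [smul_smul] using this.1

theorem TupleEquiv.double {n : ℕ} {E : Fin n → Matrix ι ι ℂ} {F : Fin n → Matrix κ κ ℂ}
    (h : TupleEquiv E F) : TupleEquiv (doubleTuple E) (doubleTuple F) := by
  obtain ⟨U, h1, h2, h3⟩ := h
  refine ⟨fromBlocks U 0 0 U, ?_, ?_, fun i => ?_⟩
  · simp [fromBlocks_conjTranspose, fromBlocks_multiply, h1]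
  · simp [fromBlocks_conjTranspose, fromBlocks_multiply, h2]
  · refine Fin.cases ?_ (fun i => Fin.cases ?_ (fun i => ?_) i) i
    · simp [fromBlocks_conjTranspose, fromBlocks_multiply, h1]
    · simp [fromBlocks_conjTranspose, fromBlocks_multiply, h1]
    · simp [fromBlocks_conjTranspose, fromBlocks_multiply, h3]

/-- Intertwining `σ_z ⊗ 1` forces `U` to be block diagonal, and intertwining `σ_x ⊗ 1` makes its two
diagonal blocks equal. The common block is the required unitary. -/
theorem TupleEquiv.of_double {n : ℕ} {E : Fin n → Matrix ι ι ℂ} {F : Fin n → Matrix κ κ ℂ}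
    (h : TupleEquiv (doubleTuple E) (doubleTuple F)) : TupleEquiv E F := by
  obtain ⟨U, h1, h2, h3⟩ := h
  have hc : ∀ i, U * doubleTuple F i = doubleTuple E i * U := fun i => by
    rw [h3, ← Matrix.mul_assoc, ← Matrix.mul_assoc, h2, Matrix.one_mul]
  obtain ⟨a, c, d, f, rfl⟩ : ∃ a c d f, U = fromBlocks a c d f :=
    ⟨_, _, _, _, (fromBlocks_toBlocks U).symm⟩
  have e0 := hc 0
  have e1 := hc 1
  simp only [doubleTuple_zero, doubleTuple_one, fromBlocks_multiply, fromBlocks_inj] at e0 e1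
  simp at e0 e1
  have hc0 : c = 0 := Matrix.eq_zero_of_eq_neg (by simpa using e0.1.symm)
  have hd0 : d = 0 := Matrix.eq_zero_of_eq_neg (by simpa using e0.2)
  obtain rfl : f = a := by simpa using e1.2.1.symm
  subst hc0 hd0
  rw [← fromBlocks_one] at h1 h2
  simp only [fromBlocks_conjTranspose, fromBlocks_multiply, fromBlocks_inj] at h1 h2
  refine ⟨f, by simpa using h1.1, by simpa using h2.1, fun i => ?_⟩
  have := h3 i.succ.succ
  simp only [doubleTuple_succ_succ, fromBlocks_conjTranspose, fromBlocks_multiply,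
    fromBlocks_inj] at this
  simpa using this.2.2.1

theorem doubleTuple_blockDiagonal_equiv {n : ℕ} {β : Type} [Fintype β] [DecidableEq β]
    (B : β → Fin n → Matrix κ κ ℂ) :
    TupleEquiv (doubleTuple (fun i => blockDiagonal fun j => B j i))
      (fun i => blockDiagonal fun j => doubleTuple (B j) i) := by
  convert TupleEquiv.reindex (Equiv.sumProdDistrib κ κ β).symm
    (doubleTuple (fun i => blockDiagonal fun j => B j i)) using 2 with i
  rw [reindex_apply, Equiv.symm_symm]
  refine Fin.cases ?_ (fun i => Fin.cases ?_ (fun i => ?_) i) i <;>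
  · ext ⟨a | a, j⟩ ⟨c | c, l⟩ <;> by_cases h : j = l <;>
    simp [blockDiagonal_apply, Matrix.one_apply, h]

/-- A tuple of at least two anticommuting hermitian involutions is a doubled tuple. -/
theorem IsCliffordTuple.exists_equiv_doubleTuple {n : ℕ} {E : Fin (n + 2) → Matrix ι ι ℂ}
    (hE : IsCliffordTuple E) :
    ∃ (s : ℕ) (F : Fin n → Matrix (Fin s) (Fin s) ℂ),
      IsCliffordTuple F ∧ TupleEquiv E (doubleTuple F) := by
  -- `V` parametrizes the `+1`-eigenspace of `E 0`. Since `E 1` anticommutes with `E 0`, it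
  -- exchanges the two eigenspaces, so `V` and `E 1 * V` together form a unitary matrix.
  obtain ⟨s, V, h1, h2⟩ := exists_isometry_of_sq_eq_one (hE.herm 0) (hE.sq 0)
  have h01 : E 0 * E 1 = -(E 1 * E 0) := hE.anti 0 1 (by simp)
  have hV : E 0 * V = V := by
    have : V = V * Vᴴ * V := by rw [Matrix.mul_assoc, h1, Matrix.mul_one]
    rw [this, h2, ← Matrix.mul_assoc]
    simp [Matrix.mul_add, hE.sq, add_comm]
  have hV' : Vᴴ * E 0 = Vᴴ := by
    have := congrArg conjTranspose hV
    rwa [conjTranspose_mul, hE.herm] at this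
  -- A matrix anticommuting with `E 0` exchanges the eigenspaces, so its compression to the
  -- `+1`-eigenspace vanishes.
  have hz : ∀ X : Matrix ι ι ℂ, E 0 * X = -(X * E 0) → Vᴴ * X * V = 0 := fun X hX => by
    apply Matrix.eq_zero_of_eq_neg
    calc Vᴴ * X * V = Vᴴ * (E 0 * X) * V := by rw [← Matrix.mul_assoc, hV']
      _ = -(Vᴴ * X * (E 0 * V)) := by rw [hX]; simp only [Matrix.mul_neg, Matrix.neg_mul,
            Matrix.mul_assoc]
      _ = _ := by rw [hV]
  have hzc : ∀ X : Matrix ι ι ℂ, E 0 * X = -(X * E 0) → Vᴴ * (X * V) = 0 := fun X hX => by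
    rw [← Matrix.mul_assoc, hz X hX]
  have q1 : ∀ X : Matrix ι (Fin s) ℂ, E 1 * (E 1 * X) = X := fun X => by
    rw [← Matrix.mul_assoc, hE.sq, Matrix.one_mul]
  -- In the basis `(V, E 1 * V)` the upper right block of `E i.succ.succ` is `Vᴴ * E i.succ.succ * E
  -- 1 * V`, which has to equal `-Complex.I • F i`.
  let F : Fin n → Matrix (Fin s) (Fin s) ℂ := fun i =>
    Complex.I • (Vᴴ * (E i.succ.succ * (E 1 * V)))
  have hEF : TupleEquiv E (doubleTuple F) := by
    have hUH : (fromCols V (E 1 * V))ᴴ = fromRows Vᴴ (Vᴴ * E 1) := by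
      rw [conjTranspose_fromCols_eq_fromRows_conjTranspose, conjTranspose_mul, hE.herm]
    refine ⟨fromCols V (E 1 * V), ?_, ?_, fun i => ?_⟩
    · rw [hUH, fromRows_mul_fromCols, ← fromBlocks_one]
      simp only [Matrix.mul_assoc, hzc _ h01, q1, h1]
    · rw [hUH, fromCols_mul_fromRows]
      have : E 1 * V * (Vᴴ * E 1) = E 1 * (V * Vᴴ) * E 1 := by simp only [Matrix.mul_assoc]
      rw [this, h2]
      simp only [Matrix.mul_smul, Matrix.smul_mul, Matrix.mul_add, Matrix.add_mul, Matrix.mul_one,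
        hE.sq, Matrix.mul_assoc, h01, Matrix.mul_neg]
      rw [← Matrix.mul_assoc (E 1) (E 1), hE.sq, Matrix.one_mul, ← smul_add]
      have : (1 : Matrix ι ι ℂ) + E 0 + (1 + -E 0) = (2 : ℂ) • 1 := by
        rw [two_smul]; abel
      rw [this, smul_smul]; norm_num
    · rw [hUH, Matrix.mul_assoc, mul_fromCols, fromRows_mul_fromCols]
      refine Fin.cases ?_ (fun i => Fin.cases ?_ (fun i => ?_) i) i
      · have : E 0 * (E 1 * V) = -(E 1 * V) := by
          rw [← Matrix.mul_assoc, h01, Matrix.neg_mul, Matrix.mul_assoc, hV]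
        simp only [doubleTuple_zero, Matrix.mul_assoc, this, hV, Matrix.mul_neg, hzc _ h01, q1,
          h1, neg_zero]
      · change fromBlocks 0 1 1 0 = _
        simp only [Fin.succ_zero_eq_one, Matrix.mul_assoc, hzc _ h01, q1, h1]
      · have a0 : E 0 * E i.succ.succ = -(E i.succ.succ * E 0) :=
          hE.anti 0 _ (Fin.succ_ne_zero _).symm
        have a1 : E i.succ.succ * E 1 = -(E 1 * E i.succ.succ) :=
          hE.anti _ 1 (by
            rw [← Fin.succ_zero_eq_one]
            exact fun h => Fin.succ_ne_zero i (Fin.succ_injective _ h))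
        have a2 : E i.succ.succ * (E 1 * V) = -(E 1 * (E i.succ.succ * V)) := by
          rw [← Matrix.mul_assoc, a1, Matrix.neg_mul, Matrix.mul_assoc]
        simp only [doubleTuple_succ_succ, Matrix.mul_assoc, F, smul_smul, hzc _ a0]
        simp only [neg_mul, Complex.I_mul_I, neg_neg, one_smul, a2, Matrix.mul_neg, q1, hzc _ a0,
          neg_smul, smul_neg, neg_zero]
  exact ⟨s, F, (hE.of_equiv hEF).of_double, hEF⟩

end Doubling

/-! ### Classification of Clifford tuples -/

section Classification

theorem TupleEquiv.blockDiagonal_reindex {τ ι κ β : Type} [Fintype ι] [Fintype κ] [Fintype β]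
    [DecidableEq ι] [DecidableEq κ] [DecidableEq β] (e : ι ≃ κ) (B : β → τ → Matrix ι ι ℂ) :
    TupleEquiv (fun i => blockDiagonal fun j => B j i)
      (fun i => blockDiagonal fun j => Matrix.reindex e e (B j i)) := by
  convert TupleEquiv.reindex (Equiv.prodCongr e (Equiv.refl β))
    (fun i => blockDiagonal fun j => B j i) using 2 with i
  ext ⟨a, j⟩ ⟨c, l⟩
  simp [blockDiagonal_apply]

/-- Existence, for each `n`, of standard tuples `B true`, `B false` of size `2 ^ (n / 2)` such that
every tuple of `n` anticommuting hermitian involutions is a direct sum of copies of these. -/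
theorem exists_standard_cliffordTuple (n : ℕ) :
    ∃ B : Bool → Fin n → Matrix (Fin (2 ^ (n / 2))) (Fin (2 ^ (n / 2))) ℂ,
      (∀ t, IsCliffordTuple (B t)) ∧ (Even n → B true = B false) ∧
      (Odd n → ¬ TupleEquiv (B true) (B false)) ∧
      ∀ (m : ℕ) (E : Fin n → Matrix (Fin m) (Fin m) ℂ), IsCliffordTuple E →
        ∃ (s : ℕ) (σ : Fin s → Bool), TupleEquiv E (fun i => blockDiagonal fun j => B (σ j) i) := by
  induction n using Nat.twoStepInduction with
  | zero =>
    refine ⟨fun _ => Fin.elim0, fun _ => ⟨fun i => i.elim0, fun i => i.elim0, fun i => i.elim0⟩,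
      fun _ => rfl, fun h => by simp at h, fun m E hE => ⟨m, fun _ => true, ?_⟩⟩
    -- With no generators, a space of dimension `m` is a sum of `m` empty tuples of size 1.
    have : Unique (Fin (2 ^ (0 / 2))) := inferInstanceAs (Unique (Fin 1))
    convert TupleEquiv.reindex (Equiv.uniqueProd (Fin m) (Fin (2 ^ (0 / 2)))).symm E using 1
  | one =>
    have : Unique (Fin (2 ^ (1 / 2))) := inferInstanceAs (Unique (Fin 1))
    refine ⟨fun t _ => boolSign t • 1, fun t => ⟨fun i => ?_, fun i => ?_, fun i j hij => ?_⟩,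
      fun h => by simp at h, fun _ => ?_, fun m E hE => ?_⟩
    · cases t <;> simp [boolSign]
    · cases t <;> simp [boolSign]
    · exact absurd (Subsingleton.elim i j) hij
    · rintro ⟨U, h1, -, h3⟩
      have h4 := h3 0
      simp only [Matrix.mul_smul, Matrix.smul_mul, Matrix.mul_one, h1] at h4
      have h5 := congrFun (congrFun h4 ⟨0, by simp⟩) ⟨0, by simp⟩
      simp [boolSign] at h5
      norm_num at h5
    · obtain ⟨W, σ, h1, h2, h3⟩ := exists_diagonalization_of_sq_eq_one (hE.herm 0) (hE.sq 0)
      refine ⟨m, σ, TupleEquiv.trans (F := fun _ => diagonal (fun i => boolSign (σ i)))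
        ⟨W, h1, h2, fun i => ?_⟩ ?_⟩
      · rw [Subsingleton.elim i 0, h3]
        calc _ = (Wᴴ * W) * diagonal (fun i => boolSign (σ i)) * (Wᴴ * W) := by rw [h1]; simp
          _ = _ := by simp only [Matrix.mul_assoc]
      · convert TupleEquiv.reindex (Equiv.uniqueProd (Fin m) (Fin (2 ^ (1 / 2)))).symm
          (fun _ : Fin 1 => diagonal (fun i => boolSign (σ i))) using 2 with i
        ext ⟨a, j⟩ ⟨c, l⟩
        by_cases h : j = l <;>
          simp [blockDiagonal_apply, h, Subsingleton.elim a c]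
  | more n ih _ =>
    obtain ⟨B, hB1, hB2, hB3, hB4⟩ := ih
    have hcard : 2 ^ (n / 2) + 2 ^ (n / 2) = 2 ^ ((n + 2) / 2) := by
      rw [show (n + 2) / 2 = n / 2 + 1 by omega, pow_succ]; ring
    let e : Fin (2 ^ (n / 2)) ⊕ Fin (2 ^ (n / 2)) ≃ Fin (2 ^ ((n + 2) / 2)) :=
      finSumFinEquiv.trans (finCongr hcard)
    have hr : ∀ t, TupleEquiv (doubleTuple (B t))
        (fun i => Matrix.reindex e e (doubleTuple (B t) i)) := fun t => TupleEquiv.reindex e _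
    refine ⟨fun t i => Matrix.reindex e e (doubleTuple (B t) i),
      fun t => (hB1 t).double.of_equiv (hr t), fun h => ?_, fun h hEq => ?_,
      fun m E hE => ?_⟩
    · simp only [hB2 ((Nat.even_add.1 h).2 even_two)]
    · exact hB3 (by simpa [Nat.odd_add] using h)
        ((((hr true).trans hEq).trans (hr false).symm).of_double)
    · obtain ⟨r, F, hF, hEF⟩ := hE.exists_equiv_doubleTuple
      obtain ⟨s, σ, hσ⟩ := hB4 r F hF
      exact ⟨s, σ, ((hEF.trans hσ.double).trans
        (doubleTuple_blockDiagonal_equiv fun j => B (σ j))).trans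
        (TupleEquiv.blockDiagonal_reindex e fun j => doubleTuple (B (σ j)))⟩

end Classification

/-! ### Affine substitutions in matrix tuples -/

section Affine

variable {ι κ τ : Type} [Fintype τ] [DecidableEq ι]

/-- The tuple obtained from `E` by the affine substitution with translation `c` and matrix `S`. -/
noncomputable def affineTuple (c : τ → ℂ) (S : Matrix τ τ ℂ) (E : τ → Matrix ι ι ℂ) (i : τ) :
    Matrix ι ι ℂ :=
  c i • 1 + ∑ k, S k i • E k

theorem TupleEquiv.affine [Fintype ι] [Fintype κ] [DecidableEq κ] {E : τ → Matrix ι ι ℂ} {F : τ → Matrix κ κ ℂ}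
    (h : TupleEquiv E F) (c : τ → ℂ) (S : Matrix τ τ ℂ) :
    TupleEquiv (affineTuple c S E) (affineTuple c S F) := by
  obtain ⟨U, h1, h2, h3⟩ := h
  refine ⟨U, h1, h2, fun i => ?_⟩
  simp only [affineTuple, Matrix.mul_add, Matrix.add_mul, Matrix.mul_smul, Matrix.smul_mul,
    Matrix.mul_one, h1, Matrix.mul_sum, Matrix.sum_mul, h3]

theorem affineTuple_affineTuple [DecidableEq τ] {S R : Matrix τ τ ℂ} (h : S * R = 1) (c : τ → ℂ)
    (E : τ → Matrix ι ι ℂ) : affineTuple (-(c ᵥ* R)) R (affineTuple c S E) = E := by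
  funext i
  simp only [affineTuple, smul_add, Finset.sum_add_distrib, Finset.smul_sum, smul_smul]
  rw [← Finset.sum_smul, Finset.sum_comm]
  simp only [← Finset.sum_smul]
  have h1 : ∀ k, ∑ j, R j i * S k j = (1 : Matrix τ τ ℂ) k i := fun k => by
    rw [← h, Matrix.mul_apply]
    exact Finset.sum_congr rfl fun _ _ => mul_comm _ _
  have h2 : ∑ j, R j i * c j = (c ᵥ* R) i := by
    simp only [vecMul, dotProduct, mul_comm]
  rw [h2, ← add_assoc, ← add_smul]
  simp [h1, Matrix.one_apply]

theorem conjTranspose_affineTuple {c : τ → ℂ} {S : Matrix τ τ ℂ} {E : τ → Matrix ι ι ℂ}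
    (hc : ∀ i, star (c i) = c i) (hS : ∀ k i, star (S k i) = S k i) (hE : ∀ i, (E i)ᴴ = E i)
    (i : τ) : (affineTuple c S E i)ᴴ = affineTuple c S E i := by
  simp only [affineTuple, conjTranspose_add, conjTranspose_smul, conjTranspose_one,
    conjTranspose_sum, hc, hS, hE]

theorem affineTuple_blockDiagonal {β : Type} [DecidableEq β] (c : τ → ℂ) (S : Matrix τ τ ℂ)
    (B : β → τ → Matrix ι ι ℂ) :
    affineTuple c S (fun i => blockDiagonal fun j => B j i) =
      fun i => blockDiagonal fun j => affineTuple c S (B j) i := by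
  funext i
  ext ⟨a, j⟩ ⟨d, l⟩
  by_cases h : j = l <;>
    simp [affineTuple, blockDiagonal_apply, Matrix.sum_apply, Matrix.one_apply, h]

theorem sum_smul_affineTuple (c : τ → ℂ) (S : Matrix τ τ ℂ) (E : τ → Matrix ι ι ℂ) (x : τ → ℂ) :
    ∑ i, x i • affineTuple c S E i = (c ⬝ᵥ x) • 1 + ∑ k, (S *ᵥ x) k • E k := by
  simp only [affineTuple, smul_add, Finset.sum_add_distrib, Finset.smul_sum, smul_smul]
  rw [← Finset.sum_smul, Finset.sum_comm]
  simp only [← Finset.sum_smul, mulVec, dotProduct, mul_comm]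

end Affine

/-! ### Clifford tuples and characteristic polynomials -/

section Clifford

theorem Matrix.fromBlocks_sub_fromBlocks {l m n o : Type} (A A' : Matrix n l ℂ) (B B' : Matrix n m ℂ)
    (C C' : Matrix o l ℂ) (D D' : Matrix o m ℂ) :
    fromBlocks A B C D - fromBlocks A' B' C' D' =
      fromBlocks (A - A') (B - B') (C - C') (D - D') := by
  simp only [sub_eq_add_neg, fromBlocks_neg, fromBlocks_add]

variable {ι κ τ : Type} [Fintype ι] [Fintype κ] [Fintype τ] [DecidableEq ι] [DecidableEq κ]

theorem IsCliffordTuple.sum_smul_mul_self [DecidableEq τ] {E : τ → Matrix ι ι ℂ} (hE : IsCliffordTuple E)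
    (y : τ → ℂ) : (∑ k, y k • E k) * (∑ k, y k • E k) = (∑ k, y k ^ 2) • 1 := by
  -- Twice the product is the double sum plus its transpose, where the terms with `i ≠ j` cancel in
  -- pairs.
  have h : (2 : ℂ) • ((∑ k, y k • E k) * (∑ k, y k • E k)) = (2 : ℂ) • ((∑ k, y k ^ 2) • 1) := by
    have s1 := Finset.sum_mul_sum Finset.univ Finset.univ (fun k => y k • E k) (fun k => y k • E k)
    have s2 := s1.trans Finset.sum_comm
    rw [two_smul]
    nth_rewrite 1 [s1]
    rw [s2, ← Finset.sum_add_distrib]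
    simp only [← Finset.sum_add_distrib]
    have h1 : ∀ i j, y i • E i * y j • E j + y j • E j * y i • E i =
        if i = j then (2 * y i ^ 2) • (1 : Matrix ι ι ℂ) else 0 := fun i j => by
      split_ifs with hij
      · subst hij
        rw [Matrix.smul_mul, Matrix.mul_smul, hE.sq, smul_smul, ← add_smul]; congr 1; ring
      · simp only [Matrix.smul_mul, Matrix.mul_smul]
        rw [hE.anti i j hij, smul_comm (y j)]; simp
    simp only [h1, Finset.sum_ite_eq, Finset.mem_univ, if_true,
      Finset.sum_smul, Finset.smul_sum, smul_smul]
  exact smul_right_injective _ (two_ne_zero : (2 : ℂ) ≠ 0) h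

theorem TupleEquiv.charpoly_sum_smul {E : τ → Matrix ι ι ℂ} {F : τ → Matrix κ κ ℂ}
    (h : TupleEquiv E F) (y : τ → ℂ) :
    (∑ k, y k • E k).charpoly = (∑ k, y k • F k).charpoly := by
  obtain ⟨U, h1, h2, h3⟩ := h
  refine Polynomial.funext fun z => ?_
  rw [eval_charpoly, eval_charpoly, ← det_conj_of_mul_eq_one (M := Uᴴ) (M' := U) h1 h2]
  congr 1
  simp only [Matrix.mul_sub, Matrix.sub_mul, h3, Matrix.mul_sum, Matrix.sum_mul, Matrix.mul_smul,
    Matrix.smul_mul, Matrix.scalar_apply, ← Matrix.smul_one_eq_diagonal, Matrix.mul_one, h1]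

/-- Two generators are essential: a single involution may have eigenvalues `1` and `-1` with
different multiplicities. In doubled form the determinant is computed by a Schur complement. -/
theorem IsCliffordTuple.charpoly_sum_smul {n r : ℕ}
    {E : Fin (n + 2) → Matrix (Fin (2 * r)) (Fin (2 * r)) ℂ} (hE : IsCliffordTuple E)
    (y : Fin (n + 2) → ℂ) :
    (∑ k, y k • E k).charpoly = (Polynomial.X ^ 2 - Polynomial.C (∑ k, y k ^ 2)) ^ r := by
  obtain ⟨s, F, hF, hEF⟩ := hE.exists_equiv_doubleTuple
  have hs : r = s := by
    have := hEF.card_eq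
    simp only [Fintype.card_fin, Fintype.card_sum] at this
    omega
  subst hs
  rw [hEF.charpoly_sum_smul]
  refine Polynomial.eq_of_infinite_eval_eq _ _ ?_
  -- Away from `z = y 0` the upper left block `(z - y 0) • 1` is invertible, and cofinitely many
  -- values determine the polynomial.
  refine (Set.finite_singleton (y 0)).infinite_compl.mono fun z hz => ?_
  have hz0 : z - y 0 ≠ 0 := sub_ne_zero.2 hz
  have hG := hF.sum_smul_mul_self (fun k => y k.succ.succ)
  have hsum : ∑ k, y k • doubleTuple F k = fromBlocks (y 0 • 1)
      (y 1 • 1 - Complex.I • ∑ k : Fin n, y k.succ.succ • F k)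
      (y 1 • 1 + Complex.I • ∑ k : Fin n, y k.succ.succ • F k) (-(y 0 • 1)) := by
    rw [Fin.sum_univ_succ, Fin.sum_univ_succ]
    have : ∑ k : Fin n, y k.succ.succ • doubleTuple F k.succ.succ = fromBlocks 0
        (-(Complex.I • ∑ k : Fin n, y k.succ.succ • F k))
        (Complex.I • ∑ k : Fin n, y k.succ.succ • F k) 0 := by
      ext (a | a) (b | b) <;>
        simp [Matrix.sum_apply, Finset.mul_sum, mul_left_comm]
    rw [this]
    simp [fromBlocks_smul, fromBlocks_add, sub_eq_add_neg]
  have hscal : Matrix.scalar (Fin r ⊕ Fin r) z = fromBlocks (z • 1) 0 0 (z • 1) := by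
    rw [Matrix.scalar_apply, ← Matrix.smul_one_eq_diagonal, ← fromBlocks_one, fromBlocks_smul]
    simp
  generalize ∑ k : Fin n, y k.succ.succ • F k = G at *
  have hprod : (0 - (y 1 • 1 + Complex.I • G)) * (0 - (y 1 • 1 - Complex.I • G)) =
      (y 1 ^ 2 + ∑ k : Fin n, y k.succ.succ ^ 2) • (1 : Matrix (Fin r) (Fin r) ℂ) := by
    rw [show y 1 ^ 2 + ∑ k : Fin n, y k.succ.succ ^ 2 =
      y 1 ^ 2 - Complex.I * Complex.I * ∑ k : Fin n, y k.succ.succ ^ 2 by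
        rw [Complex.I_mul_I]; ring]
    simp only [zero_sub, neg_mul_neg, Matrix.add_mul, Matrix.mul_sub, Matrix.smul_mul,
      Matrix.mul_smul, Matrix.one_mul, Matrix.mul_one, smul_smul, hG]
    module
  have hA : z • (1 : Matrix (Fin r) (Fin r) ℂ) - y 0 • 1 = (z - y 0) • 1 := (sub_smul _ _ _).symm
  let _ : Invertible ((z - y 0) • (1 : Matrix (Fin r) (Fin r) ℂ)) :=
    ⟨(z - y 0)⁻¹ • 1, by simp [smul_smul, hz0], by simp [smul_smul, hz0]⟩
  have hinv : ⅟((z - y 0) • (1 : Matrix (Fin r) (Fin r) ℂ)) = (z - y 0)⁻¹ • 1 := rfl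
  change Polynomial.eval z _ = Polynomial.eval z _
  rw [eval_charpoly, hsum, hscal, fromBlocks_sub_fromBlocks, hA, det_fromBlocks₁₁, hinv, Matrix.mul_smul,
    Matrix.mul_one, Matrix.smul_mul, hprod]
  have : z • (1 : Matrix (Fin r) (Fin r) ℂ) - -(y 0 • 1) -
      (z - y 0)⁻¹ • (y 1 ^ 2 + ∑ k : Fin n, y k.succ.succ ^ 2) • 1 =
      (z + y 0 - (z - y 0)⁻¹ * (y 1 ^ 2 + ∑ k : Fin n, y k.succ.succ ^ 2)) • 1 := by module
  rw [this, det_smul, det_smul, det_one, Fintype.card_fin, mul_one, mul_one, ← mul_pow]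
  simp only [Polynomial.eval_pow, Polynomial.eval_sub, Polynomial.eval_X, Polynomial.eval_C]
  congr 1
  rw [Fin.sum_univ_succ, Fin.sum_univ_succ, Fin.succ_zero_eq_one]
  field_simp
  ring

/-- For hermitian `K = H ^ (2 ^ m)`, `K² = Kᴴ K = 0` implies `K = 0`, so the exponent can be halved
repeatedly. -/
theorem Matrix.eq_zero_of_hermitian_of_pow_eq_zero {H : Matrix ι ι ℂ} (hH : Hᴴ = H) {r : ℕ}
    (h : H ^ r = 0) : H = 0 := by
  have key : ∀ m : ℕ, H ^ (2 ^ m) = 0 → H = 0 := fun m => by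
    induction m with
    | zero => simp
    | succ m ih =>
      intro h
      apply ih
      rw [← conjTranspose_mul_self_eq_zero, conjTranspose_pow, hH, ← pow_add, ← two_mul,
        ← pow_succ', h]
  exact key r (pow_eq_zero_of_le Nat.lt_two_pow_self.le h)

/-- Hermitian tuples whose pencils have the characteristic polynomials of a Clifford tuple are
Clifford tuples. -/
theorem IsCliffordTuple.of_charpoly [DecidableEq τ] {r : ℕ} {E : τ → Matrix ι ι ℂ} (hE : ∀ i, (E i)ᴴ = E i)
    (h : ∀ y : τ → ℂ, (∑ k, y k • E k).charpoly =
      (Polynomial.X ^ 2 - Polynomial.C (∑ k, y k ^ 2)) ^ r) : IsCliffordTuple E := by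
  -- Real coefficients keep the pencil hermitian, so the nilpotent matrix supplied by
  -- Cayley–Hamilton vanishes.
  have key : ∀ y : τ → ℝ, (∑ k, (y k : ℂ) • E k) * (∑ k, (y k : ℂ) • E k) =
      (∑ k, (y k : ℂ) ^ 2) • 1 := fun y => by
    have h1 := aeval_self_charpoly (∑ k, (y k : ℂ) • E k)
    rw [h fun k => (y k : ℂ)] at h1
    simp only [map_pow, map_sub, Polynomial.aeval_X, Polynomial.aeval_C,
      Algebra.algebraMap_eq_smul_one] at h1
    rw [← pow_two, ← sub_eq_zero]
    refine eq_zero_of_hermitian_of_pow_eq_zero ?_ h1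
    have hs : (∑ k, (y k : ℂ) • E k)ᴴ = ∑ k, (y k : ℂ) • E k := by
      simp [conjTranspose_sum, conjTranspose_smul, hE]
    rw [conjTranspose_sub, conjTranspose_pow, hs, conjTranspose_smul]
    simp
  have hsq : ∀ i, E i * E i = 1 := fun i => by
    simpa [Pi.single_apply, ite_smul, apply_ite Complex.ofReal, ite_pow] using key (Pi.single i 1)
  refine ⟨hE, hsq, fun i j hij => ?_⟩
  -- Polarization: the vector `e_i + e_j` extracts the anticommutator of `E i` and `E j`.
  have h1 : ∑ k, (((Pi.single i 1 + Pi.single j 1 : τ → ℝ) k : ℝ) : ℂ) • E k = E i + E j := by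
    simp [Pi.single_apply, add_smul, Finset.sum_add_distrib]
  have h2 : ∑ k, (((Pi.single i 1 + Pi.single j 1 : τ → ℝ) k : ℝ) : ℂ) ^ 2 = 2 := by
    rw [← Finset.add_sum_erase _ _ (Finset.mem_univ i),
      ← Finset.add_sum_erase _ _ (Finset.mem_erase.2 ⟨hij.symm, Finset.mem_univ j⟩),
      Finset.sum_eq_zero]
    · simp [hij, hij.symm]; norm_num
    · intro k hk
      simp only [Finset.mem_erase] at hk
      simp [hk.1, hk.2.1]
  have h3 := key (Pi.single i 1 + Pi.single j 1)
  rw [h1, h2, Matrix.add_mul, Matrix.mul_add, Matrix.mul_add, hsq, hsq, two_smul] at h3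
  rw [eq_neg_iff_add_eq_zero]
  have : E i * E j + E j * E i = (1 + E i * E j + (E j * E i + 1)) - (1 + 1) := by abel
  rw [this, h3, sub_self]

end Clifford

/-! ### Determinantal representations as affine images of Clifford tuples -/

section DetRep

theorem eval_det_linearMatrixPoly {n m : ℕ} (M : Fin n → Matrix (Fin m) (Fin m) ℂ)
    (x : Fin n → ℂ) :
    MvPolynomial.eval x (linearMatrixPoly M).det = (1 + ∑ i, x i • M i).det := by
  rw [RingHom.map_det]
  congr 1
  ext a c
  simp [linearMatrixPoly, Matrix.sum_apply, Matrix.one_apply, apply_ite (MvPolynomial.eval x)]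

theorem isDetRep_iff {n m : ℕ} (M : Fin n → Matrix (Fin m) (Fin m) ℂ)
    (q : MvPolynomial (Fin n) ℝ) :
    IsDetRep M q ↔ (∀ i, (M i)ᴴ = M i) ∧
      ∀ x : Fin n → ℂ, (1 + ∑ i, x i • M i).det = MvPolynomial.aeval x q := by
  refine and_congr Iff.rfl ⟨fun h x => ?_, fun h => MvPolynomial.funext fun x => ?_⟩
  · rw [← eval_det_linearMatrixPoly, h, MvPolynomial.eval_map, MvPolynomial.aeval_def]
  · rw [eval_det_linearMatrixPoly, h, MvPolynomial.eval_map, MvPolynomial.aeval_def]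

/-- The even size makes the determinant insensitive to the sign change turning `z + N` into the
characteristic matrix at `-z`. -/
theorem Matrix.det_smul_one_add {m r : ℕ} (hm : m = 2 * r) {N : Matrix (Fin m) (Fin m) ℂ} {q : ℂ}
    (hN : N.charpoly = (Polynomial.X ^ 2 - Polynomial.C q) ^ r) (z : ℂ) :
    (z • 1 + N).det = (z ^ 2 - q) ^ r := by
  subst hm
  have h := congrArg (Polynomial.eval (-z)) hN
  rw [eval_charpoly, scalar_apply, ← smul_one_eq_diagonal,
    show (-z) • (1 : Matrix (Fin (2 * r)) (Fin (2 * r)) ℂ) - N = -(z • 1 + N) by module, det_neg,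
    Fintype.card_fin, pow_mul] at h
  simpa using h

variable {n : ℕ} {c : Fin n → ℂ} {S R : Matrix (Fin n) (Fin n) ℂ} {p : MvPolynomial (Fin n) ℝ}
  {m r : ℕ}

theorem IsCliffordTuple.isDetRep_affineTuple (hn : 2 ≤ n) (hc : ∀ i, star (c i) = c i)
    (hS : ∀ k i, star (S k i) = S k i)
    (hp : ∀ x, MvPolynomial.aeval x p = (1 + c ⬝ᵥ x) ^ 2 - ∑ k, (S *ᵥ x) k ^ 2) (hm : m = 2 * r)
    {E : Fin n → Matrix (Fin m) (Fin m) ℂ} (hE : IsCliffordTuple E) :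
    IsDetRep (affineTuple c S E) (p ^ r) := by
  obtain ⟨n, rfl⟩ := Nat.exists_eq_add_of_le' hn
  subst hm
  rw [isDetRep_iff]
  refine ⟨conjTranspose_affineTuple hc hS hE.herm, fun x => ?_⟩
  rw [sum_smul_affineTuple, ← add_assoc, map_pow, hp]
  rw [← det_smul_one_add rfl (hE.charpoly_sum_smul (S *ᵥ x)) (1 + c ⬝ᵥ x), add_smul, one_smul]

theorem IsDetRep.exists_isCliffordTuple (hc : ∀ i, star (c i) = c i)
    (hR : ∀ k i, star (R k i) = R k i) (hSR : S * R = 1)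
    (hp : ∀ x, MvPolynomial.aeval x p = (1 + c ⬝ᵥ x) ^ 2 - ∑ k, (S *ᵥ x) k ^ 2) (hm : m = 2 * r)
    {M : Fin n → Matrix (Fin m) (Fin m) ℂ} (hM : IsDetRep M (p ^ r)) :
    ∃ E : Fin n → Matrix (Fin m) (Fin m) ℂ, IsCliffordTuple E ∧ M = affineTuple c S E := by
  have hRS : R * S = 1 := mul_eq_one_comm.1 hSR
  rw [isDetRep_iff] at hM
  obtain ⟨hMh, hMdet⟩ := hM
  set E := affineTuple (-(c ᵥ* R)) R M with hE
  have hME : M = affineTuple c S E := by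
    have := affineTuple_affineTuple hRS (-(c ᵥ* R)) M
    rw [neg_vecMul, neg_neg, vecMul_vecMul, hRS, vecMul_one] at this
    exact this.symm
  have hEh : ∀ i, (E i)ᴴ = E i := conjTranspose_affineTuple
    (fun i => by simp only [Pi.neg_apply, vecMul, dotProduct, star_neg, star_sum, star_mul', hc,
      hR]) hR hMh
  refine ⟨E, IsCliffordTuple.of_charpoly (r := r) hEh fun y => ?_, hME⟩
  have hy : S *ᵥ (R *ᵥ y) = y := by rw [mulVec_mulVec, hSR, one_mulVec]
  set x := R *ᵥ y with hx
  refine Polynomial.eq_of_infinite_eval_eq _ _ ?_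
  -- Dehomogenization: with `w = z + c·x` nonzero, the characteristic matrix of `∑ y_k E_k` at `z`
  -- is `w` times the pencil of `M` at `-x/w`, whose determinant is known.
  refine (Set.finite_singleton (-(c ⬝ᵥ x))).infinite_compl.mono fun z hz => ?_
  have hw : z + c ⬝ᵥ x ≠ 0 := fun h => hz (eq_neg_of_add_eq_zero_left h)
  obtain ⟨w, hwdef⟩ : ∃ w, w = z + c ⬝ᵥ x := ⟨_, rfl⟩
  rw [← hwdef] at hw
  change Polynomial.eval z _ = Polynomial.eval z _
  have h1 := hMdet ((-w⁻¹) • x)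
  have h2 : ∑ i, ((-w⁻¹) • x) i • M i = (-w⁻¹) • ((c ⬝ᵥ x) • 1 + ∑ k, y k • E k) := by
    conv_lhs => rw [hME]
    rw [sum_smul_affineTuple, mulVec_smul, hy, dotProduct_smul, smul_add, Finset.smul_sum]
    simp [smul_smul]
  have h3 : (Matrix.scalar (Fin m) z) - ∑ k, y k • E k =
      w • (1 + (-w⁻¹) • ((c ⬝ᵥ x) • 1 + ∑ k, y k • E k)) := by
    rw [smul_add, smul_smul, scalar_apply, ← smul_one_eq_diagonal, mul_neg, mul_inv_cancel₀ hw,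
      hwdef]
    module
  rw [eval_charpoly, h3, det_smul, ← h2, h1, map_pow, hp, Fintype.card_fin, hm, pow_mul, ← mul_pow]
  simp only [Polynomial.eval_pow, Polynomial.eval_sub, Polynomial.eval_X, Polynomial.eval_C,
    mulVec_smul, hy, dotProduct_smul, Pi.smul_apply, smul_eq_mul, mul_pow, ← Finset.mul_sum]
  obtain rfl : z = w - c ⬝ᵥ x := eq_sub_of_add_eq hwdef.symm
  rw [← mul_pow]
  congr 1
  field_simp
  ring

end DetRep

/-! ### Normal form of a quadratic real zero polynomial -/

section RealZero

variable {n : ℕ} (A : Matrix (Fin n) (Fin n) ℝ) (b : Fin n → ℝ)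

theorem aeval_quadraticPoly (x : Fin n → ℂ) :
    MvPolynomial.aeval x (quadraticPoly A b) =
      (1 + (fun i => ((b i / 2 : ℝ) : ℂ)) ⬝ᵥ x) ^ 2 -
        x ⬝ᵥ (((1 / 4 : ℝ) • vecMulVec b b - A).map Complex.ofReal *ᵥ x) := by
  have h : x ⬝ᵥ (((1 / 4 : ℝ) • vecMulVec b b - A).map Complex.ofReal *ᵥ x) =
      ((fun i => ((b i / 2 : ℝ) : ℂ)) ⬝ᵥ x) ^ 2 - ∑ i, ∑ j, (A i j : ℂ) * (x i * x j) := by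
    simp only [dotProduct, mulVec, pow_two, Finset.sum_mul_sum]
    simp only [← Finset.sum_sub_distrib, Finset.mul_sum]
    refine Finset.sum_congr rfl fun i _ => Finset.sum_congr rfl fun j _ => ?_
    simp [vecMulVec_apply]
    ring
  have h2 : MvPolynomial.aeval x (quadraticPoly A b) =
      ∑ i, ∑ j, (A i j : ℂ) * (x i * x j) + ∑ i, (b i : ℂ) * x i + 1 := by
    simp [quadraticPoly]
  have h3 : ∑ i, (b i : ℂ) * x i = 2 * (fun i => ((b i / 2 : ℝ) : ℂ)) ⬝ᵥ x := by
    rw [dotProduct, Finset.mul_sum]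
    refine Finset.sum_congr rfl fun i _ => ?_
    push_cast
    ring
  rw [h, h2, h3]
  ring

/-- On the line through `a` the polynomial is `(1 + μl)² - μ²q`, where `q` is the value of the
quadratic form at `a`. If `q < 0`, its zeros are not real. -/
theorem IsRealZero.posSemidef_discriminant {A : Matrix (Fin n) (Fin n) ℝ} {b : Fin n → ℝ}
    (hA : A.IsSymm) (h : IsRealZero (quadraticPoly A b)) :
    ((1 / 4 : ℝ) • vecMulVec b b - A).PosSemidef := by
  have hH : ((1 / 4 : ℝ) • vecMulVec b b - A).IsHermitian := by
    ext i j
    simp [vecMulVec_apply, hA.apply i j, mul_comm (b i)]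
  refine .of_dotProduct_mulVec_nonneg hH fun a => ?_
  rw [star_trivial]
  by_contra hneg
  push Not at hneg
  set q := a ⬝ᵥ (((1 / 4 : ℝ) • vecMulVec b b - A) *ᵥ a) with hq
  set l := (fun i => b i / 2) ⬝ᵥ a with hl
  -- `w` is the reciprocal of a zero `μ`, that is, a solution of `(w + l)² = q`.
  set w : ℂ := -l + Complex.I * (Real.sqrt (-q) : ℝ) with hw
  have hsq : ((Real.sqrt (-q) : ℝ) : ℂ) ^ 2 = -q := by
    rw [← Complex.ofReal_pow, Real.sq_sqrt (by linarith)]; simp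
  have him : w.im = Real.sqrt (-q) := by simp [hw]
  have hpos : 0 < Real.sqrt (-q) := Real.sqrt_pos.2 (by linarith)
  have hw0 : w ≠ 0 := fun h0 => by
    rw [h0] at him; simp at him; linarith
  have hl' : (fun i => ((b i / 2 : ℝ) : ℂ)) ⬝ᵥ (fun i => w⁻¹ * (a i : ℂ)) = w⁻¹ * l := by
    simp only [hl, dotProduct, Complex.ofReal_sum, Complex.ofReal_mul, Finset.mul_sum]
    exact Finset.sum_congr rfl fun _ _ => by ring
  have hq' : (fun i => w⁻¹ * (a i : ℂ)) ⬝ᵥ (((1 / 4 : ℝ) • vecMulVec b b - A).map Complex.ofReal *ᵥ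
      (fun i => w⁻¹ * (a i : ℂ))) = w⁻¹ ^ 2 * q := by
    simp only [hq, dotProduct, mulVec, Complex.ofReal_sum, Complex.ofReal_mul, Finset.mul_sum,
      map_apply]
    exact Finset.sum_congr rfl fun _ _ => Finset.sum_congr rfl fun _ _ => by ring
  have h0 := h.2 a w⁻¹ (by
    rw [aeval_quadraticPoly, hl', hq']
    have : (w + l) ^ 2 - q = 0 := by
      rw [hw]; ring_nf; rw [Complex.I_sq, hsq]; ring
    field_simp
    rw [this, mul_zero])
  rw [Complex.inv_im] at h0
  have h1 : Complex.normSq w ≠ 0 := by simpa using hw0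
  have : w.im = 0 := by
    have := (div_eq_zero_iff.1 h0).resolve_right h1
    linarith
  linarith

/-- After an affine change of variables, a nondegenerate quadratic real zero polynomial is
`(1 + c ⬝ x)² - ∑ (S x)ₖ²` with real `c` and real invertible `S`. -/
theorem IsRealZero.exists_normal_form {A : Matrix (Fin n) (Fin n) ℝ} {b : Fin n → ℝ}
    (hA : A.IsSymm) (h : IsRealZero (quadraticPoly A b))
    (hinv : IsUnit ((1 / 4 : ℝ) • vecMulVec b b - A)) :
    ∃ (c : Fin n → ℂ) (S R : Matrix (Fin n) (Fin n) ℂ), (∀ i, star (c i) = c i) ∧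
      (∀ k i, star (S k i) = S k i) ∧ (∀ k i, star (R k i) = R k i) ∧ S * R = 1 ∧
      ∀ x, MvPolynomial.aeval x (quadraticPoly A b) =
        (1 + c ⬝ᵥ x) ^ 2 - ∑ k, (S *ᵥ x) k ^ 2 := by
  obtain ⟨T, hT⟩ : ∃ T : Matrix (Fin n) (Fin n) ℝ,
      (1 / 4 : ℝ) • vecMulVec b b - A = Tᵀ * T := by
    open scoped MatrixOrder in
    exact CStarAlgebra.nonneg_iff_eq_star_mul_self.mp (h.posSemidef_discriminant hA).nonneg
  have hTu : IsUnit T.det := by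
    rw [isUnit_iff_isUnit_det, hT, det_mul] at hinv
    exact isUnit_of_mul_isUnit_right hinv
  refine ⟨fun i => ((b i / 2 : ℝ) : ℂ), T.map Complex.ofReal, T⁻¹.map Complex.ofReal,
    fun i => Complex.conj_ofReal _, fun k i => Complex.conj_ofReal _,
    fun k i => Complex.conj_ofReal _, ?_, fun x => ?_⟩
  · have := congrArg (fun X : Matrix (Fin n) (Fin n) ℝ => X.map Complex.ofRealHom)
      (mul_nonsing_inv T hTu)
    have h1 : (1 : Matrix (Fin n) (Fin n) ℝ).map Complex.ofRealHom = 1 := by simp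
    rw [Matrix.map_mul, h1] at this
    exact this
  · rw [aeval_quadraticPoly, hT]
    have h1 : (Tᵀ * T).map Complex.ofReal =
        (T.map Complex.ofReal)ᵀ * T.map Complex.ofReal := by
      rw [← Matrix.transpose_map]
      exact Matrix.map_mul (f := Complex.ofRealHom)
    rw [h1, ← mulVec_mulVec, dotProduct_mulVec, vecMul_transpose]
    simp only [dotProduct, pow_two]

end RealZero

/-! ### Translation to unitary equivalence and block splitting -/

section UnitaryEquivalence

variable {n m k s : ℕ}

theorem unitarilyEquivalent_iff {M N : Fin n → Matrix (Fin m) (Fin m) ℂ} :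
    UnitarilyEquivalent M N ↔ TupleEquiv M N :=
  ⟨fun ⟨U, hU, h⟩ => ⟨U, (Unitary.mem_iff.1 hU).1, (Unitary.mem_iff.1 hU).2, h⟩,
    fun ⟨U, h1, h2, h⟩ => ⟨U, Unitary.mem_iff.2 ⟨h1, h2⟩, h⟩⟩

theorem TupleEquiv.splitsInto {M : Fin n → Matrix (Fin m) (Fin m) ℂ}
    {B : Fin s → Fin n → Matrix (Fin k) (Fin k) ℂ}
    (h : TupleEquiv M (fun i => blockDiagonal fun j => B j i)) : SplitsInto M B := by
  -- Any bijection serves, since reindexing is a unitary conjugation.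
  let e : Fin k × Fin s ≃ Fin m := Fintype.equivOfCardEq h.card_eq.symm
  exact ⟨e, unitarilyEquivalent_iff.2 (h.trans (TupleEquiv.reindex e _))⟩

theorem TupleEquiv.blockDiagonal_unique {τ ι β : Type} [Fintype ι] [DecidableEq ι] [Fintype β]
    [DecidableEq β] [Unique β] (B : β → τ → Matrix ι ι ℂ) :
    TupleEquiv (fun i => blockDiagonal fun j => B j i) (B default) := by
  convert TupleEquiv.reindex (Equiv.prodUnique ι β) (fun i => blockDiagonal fun j => B j i)
    using 2 with i
  ext a c
  simp [blockDiagonal_apply]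

end UnitaryEquivalence

/-! ### Determinantal representations of powers of `p` -/

theorem mainTheorem8 (n : ℕ) (hn : 2 ≤ n) (A : Matrix (Fin n) (Fin n) ℝ) (hA : A.IsSymm)
    (b : Fin n → ℝ) (p : MvPolynomial (Fin n) ℝ) (hp : p = quadraticPoly A b)
    (hRZ : IsRealZero p)
    (hinv : IsUnit ((1 / 4 : ℝ) • Matrix.vecMulVec b b - A))
    (k : ℕ) (hk : k = 2 ^ (n / 2)) :
    (∀ (r : ℕ), 1 ≤ r → ∀ M : Fin n → Matrix (Fin (2 * r)) (Fin (2 * r)) ℂ,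
      IsDetRep M (p ^ r) →
        ∃ s : ℕ, 1 ≤ s ∧ r = s * (k / 2) ∧
          ∃ B : Fin s → Fin n → Matrix (Fin k) (Fin k) ℂ,
            (∀ j, IsDetRep (B j) (p ^ (k / 2))) ∧ SplitsInto M B) ∧
    (Even n →
      (∃ M : Fin n → Matrix (Fin k) (Fin k) ℂ, IsDetRep M (p ^ (k / 2))) ∧
        ∀ M N : Fin n → Matrix (Fin k) (Fin k) ℂ,
          IsDetRep M (p ^ (k / 2)) → IsDetRep N (p ^ (k / 2)) → UnitarilyEquivalent M N) ∧
    (Odd n →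
      ∃ M₁ M₂ : Fin n → Matrix (Fin k) (Fin k) ℂ,
        IsDetRep M₁ (p ^ (k / 2)) ∧ IsDetRep M₂ (p ^ (k / 2)) ∧
          ¬ UnitarilyEquivalent M₁ M₂ ∧
          ∀ N : Fin n → Matrix (Fin k) (Fin k) ℂ, IsDetRep N (p ^ (k / 2)) →
            UnitarilyEquivalent N M₁ ∨ UnitarilyEquivalent N M₂) := by
  subst hp hk
  obtain ⟨c, S, R, hc, hS, hR, hSR, hp⟩ := hRZ.exists_normal_form hA hinv
  obtain ⟨B, hB, hBeven, hBodd, hBall⟩ := exists_standard_cliffordTuple n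
  -- `n ≥ 2` makes `k` even, so the natural number quotient `k / 2` is exact.
  have hk2 : 2 ^ (n / 2) = 2 * (2 ^ (n / 2) / 2) :=
    (Nat.mul_div_cancel' (dvd_pow_self 2 (by omega))).symm
  have hrep : ∀ t, IsDetRep (affineTuple c S (B t)) (quadraticPoly A b ^ (2 ^ (n / 2) / 2)) :=
    fun t => (hB t).isDetRep_affineTuple hn hc hS hp hk2
  have hclass : ∀ N : Fin n → Matrix (Fin (2 ^ (n / 2))) (Fin (2 ^ (n / 2))) ℂ,
      IsDetRep N (quadraticPoly A b ^ (2 ^ (n / 2) / 2)) →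
        ∃ t, TupleEquiv N (affineTuple c S (B t)) := fun N hN => by
    obtain ⟨E, hE, rfl⟩ := hN.exists_isCliffordTuple hc hR hSR hp hk2
    obtain ⟨s, σ, hσ⟩ := hBall _ E hE
    -- A representation of size `k` has room for exactly one standard block.
    obtain rfl : s = 1 := by
      have := hσ.card_eq
      simp only [Fintype.card_prod, Fintype.card_fin] at this
      exact Nat.eq_of_mul_eq_mul_left (pow_pos two_pos (n / 2)) (by rw [← this, mul_one])
    exact ⟨_, (hσ.trans (TupleEquiv.blockDiagonal_unique fun j => B (σ j))).affine c S⟩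
  refine ⟨fun r hr M hM => ?_, fun hEven => ⟨⟨_, hrep true⟩, fun M N hM hN => ?_⟩, fun hOdd =>
    ⟨_, _, hrep true, hrep false, fun h => ?_, fun N hN => ?_⟩⟩
  · obtain ⟨E, hE, rfl⟩ := hM.exists_isCliffordTuple hc hR hSR hp rfl
    obtain ⟨s, σ, hσ⟩ := hBall _ E hE
    have hcard := hσ.card_eq
    simp only [Fintype.card_prod, Fintype.card_fin] at hcard
    have hrs : r = s * (2 ^ (n / 2) / 2) := by
      rw [hk2, mul_assoc] at hcard
      rw [Nat.eq_of_mul_eq_mul_left two_pos hcard, mul_comm]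
    refine ⟨s, Nat.one_le_iff_ne_zero.2 ?_, hrs, fun j => affineTuple c S (B (σ j)),
      fun j => hrep _, TupleEquiv.splitsInto ?_⟩
    · rintro rfl
      omega
    · have := hσ.affine c S
      rwa [affineTuple_blockDiagonal] at this
  · obtain ⟨t, ht⟩ := hclass M hM
    obtain ⟨u, hu⟩ := hclass N hN
    have : B t = B u := by
      cases t <;> cases u <;> simp [hBeven hEven]
    rw [← this] at hu
    exact unitarilyEquivalent_iff.2 (ht.trans hu.symm)
  -- The inverse affine substitution would carry an equivalence back to the two inequivalent
  -- Clifford tuples.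
  · have := (unitarilyEquivalent_iff.1 h).affine (-(c ᵥ* R)) R
    rw [affineTuple_affineTuple hSR, affineTuple_affineTuple hSR] at this
    exact hBodd hOdd this
  · obtain ⟨t, ht⟩ := hclass N hN
    cases t
    · exact .inr (unitarilyEquivalent_iff.2 ht)
    · exact .inl (unitarilyEquivalent_iff.2 ht)
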